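/- Conventions. All graphs and simplicial complexes are finite; the simplices of a complex are non-empty sets. For a vertex $x$ of a graph, the unit sphere $S(x)$ is the subgraph induced on the neighbours of $x$. A graph is contractible if it has exactly one vertex, or if it has a vertex $x$ such that both $S(x)$ and the graph with $x$ removed are contractible. The empty graph is the $(-1)$-sphere. A graph is a $d$-manifold if all its unit spheres $S(x)$ are $(d-1)$-spheres, and for $d\ge 0$ a $d$-sphere is a $d$-manifold that becomes contractible after the removal of some vertex. For a simplex $x$ of a simplicial complex $G$, the unit sphere $S(x)$ is the graph whose vertices are the simplices of $G$ strictly contained in $x$ or strictly containing $x$, two of them being adjacent if one is strictly contained in the other; $G$ is a $d$-manifold if $S(x)$ is a $(d-1)$-sphere for every simplex $x\in G$. Corollary. Let $d,k\ge 0$, let $G$ be a simplicial complex with vertex set $V$ that is a $d$-manifold, and let $f: V\to\{0,1,\dots,k\}$ be surjective. Let $P=K_{k+1}=K_{(1,\dots,1)}$ be the complex of all non-empty subsets of $\{0,\dots,k\}$. Let $U$ be the set of simplices $y\in G$ such that $f(y)$ contains a facet of $P$, that is, $f(y)=\{0,\dots,k\}$. Regard $U$ as a graph in which two simplices are adjacent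 if one is strictly contained in the other, and let $H=H(G,f,P)$ be the simplicial complex of its non-empty complete subgraphs. Then $H$ is a $(d-k)$-manifold or empty; more precisely, if $H$ is non-empty, then both the graph $U$ and the complex $H$ are $(d-k)$-manifolds. -/

import Mathlib

namespace DiscreteManifold

/-! ### Contractible graphs, spheres and manifolds

All finite graphs are handled as induced subgraphs of an ambient simple graph `Γ` on `W`: a set
`A : Set W` stands for the subgraph of `Γ` induced on `A`. -/

section Graphs

variable {W : Type*}

/-- The unit sphere `S(x)` in the graph induced on `A`: the subgraph induced on the neighbours of
`x`. -/
def unitSphere (Γ : SimpleGraph W) (A : Set W) (x : W) : Set W :=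
  {y | y ∈ A ∧ Γ.Adj x y}

/-- Contractible graphs: the one-point graph is contractible, and a graph is contractible if it has
a vertex `x` such that both `S(x)` and the graph without `x` are contractible.
(The empty graph is not contractible; contractible graphs are finite.) -/
inductive IsContractible (Γ : SimpleGraph W) : Set W → Prop
  | point (x : W) : IsContractible Γ {x}
  | extend (A : Set W) (x : W) (hx : x ∈ A)
      (hS : IsContractible Γ (unitSphere Γ A x))
      (hA : IsContractible Γ (A \ {x})) : IsContractible Γ A

/-- Spheres: the empty graph is the `(-1)`-sphere, and for `d ≥ 0` a `d`-sphere is a graph all of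
whose unit spheres are `(d-1)`-spheres (a `d`-manifold) and which becomes contractible after the
removal of some vertex. -/
inductive IsSphere (Γ : SimpleGraph W) : ℤ → Set W → Prop
  | empty : IsSphere Γ (-1) ∅
  | step (d : ℤ) (hd : 0 ≤ d) (A : Set W)
      (hS : ∀ x ∈ A, IsSphere Γ (d - 1) (unitSphere Γ A x))
      (hA : ∃ x ∈ A, IsContractible Γ (A \ {x})) : IsSphere Γ d A

/-- A `d`-manifold is a finite graph all of whose unit spheres are `(d-1)`-spheres. -/
def IsManifoldGraph (Γ : SimpleGraph W) (d : ℤ) (A : Set W) : Prop :=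
  A.Finite ∧ ∀ x ∈ A, IsSphere Γ (d - 1) (unitSphere Γ A x)

/-- The simplicial complex of the (non-empty, finite) complete subgraphs of the graph induced
on `A`. -/
def cliqueComplex (Γ : SimpleGraph W) (A : Set W) : PreAbstractSimplicialComplex W where
  faces := {s | s.Nonempty ∧ (s : Set W) ⊆ A ∧ Γ.IsClique (s : Set W)}
  isRelLowerSet_faces := by
    rintro s ⟨hne, hA, hc⟩
    refine ⟨hne, fun t hts ht => ⟨ht, ?_, ?_⟩⟩
    · exact (Finset.coe_subset.mpr hts).trans hA
    · exact hc.subset (Finset.coe_subset.mpr hts)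

end Graphs

/-! ### Complexes -/

section Complexes

variable {V β : Type*}

/-- The graph on finite sets in which two different sets are adjacent if one contains the other. -/
def inclusionGraph (V : Type*) : SimpleGraph (Finset V) where
  Adj a b := a ⊂ b ∨ b ⊂ a
  symm := ⟨fun _ _ h => h.symm⟩
  loopless := ⟨fun a h => h.elim (ssubset_irrefl a) (ssubset_irrefl a)⟩

/-- A finite simplicial complex is a `d`-manifold if for every simplex `x` the unit sphere `S(x)`
is a `(d-1)`-sphere. Here `S(x)` is the join of `S⁻(x)`, the simplices strictly contained in `x`,
and `S⁺(x)`, the simplices strictly containing `x`; that is, the unit sphere of `x` in the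
inclusion graph on the set of simplices. -/
def IsManifold (d : ℤ) (K : PreAbstractSimplicialComplex V) : Prop :=
  IsManifoldGraph (inclusionGraph V) d K.faces

/-- The set `U` of simplices `y` of `G` whose image `f(y)` contains a facet (maximal simplex)
of `P`. -/
def pullbackSet [DecidableEq β] (G : AbstractSimplicialComplex V) (f : V → β)
    (P : PreAbstractSimplicialComplex β) : Set (Finset V) :=
  {y | y ∈ G.faces ∧ ∃ t, Maximal (fun s => s ∈ P.faces) t ∧ t ⊆ y.image f}

/-- `H(G, f, P)`: the complex of complete subgraphs of the inclusion graph on `U`. -/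
def pullback [DecidableEq β] (G : AbstractSimplicialComplex V) (f : V → β)
    (P : PreAbstractSimplicialComplex β) : PreAbstractSimplicialComplex (Finset V) :=
  cliqueComplex (inclusionGraph V) (pullbackSet G f P)

/-- The complete complex `K_{k+1} = K_{(1,…,1)}` on the vertex set `{0,…,k}`: every non-empty
subset is a simplex. -/
def completeComplex (k : ℕ) : PreAbstractSimplicialComplex (Fin (k + 1)) := ⊤

end Complexes

end DiscreteManifold

/-!
The unit sphere of a simplex `y` of `U` is the join of the simplices of `U` below `y` and those
above `y`. All simplices of `G` above `y` lie in `U`; they form a `(d - #y)`-sphere, because adding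
a vertex to a simplex `c` passes to the unit sphere of a point among the simplices above `c`. The
simplices of `U` below `y` are the proper faces of a product of simplices of total dimension
`#y - (k + 1)`, and hence form a `(#y - k - 2)`-sphere. For the complex of complete subgraphs of a
manifold graph, the complete subgraphs above `{x}` form a barycentric refinement of the unit sphere
of `x`, which is a sphere of the same dimension.

Contractibility is obtained throughout from monotone retractions `g` of a poset onto a subset such
that every `x` is comparable to `g x`: such a retraction removes one dominated vertex at a time.
-/

namespace DiscreteManifold

open Set Function
open scoped Finset

section Graphs

variable {W : Type*} {Γ : SimpleGraph W} {A B : Set W} {x : W}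

lemma unitSphere_subset_sdiff : unitSphere Γ A x ⊆ A \ {x} :=
  fun _ hy => ⟨hy.1, hy.2.ne'⟩

lemma IsContractible.finite (h : IsContractible Γ A) : A.Finite := by
  induction h with
  | point x => exact finite_singleton x
  | extend A x _ _ _ _ ih => exact ih.of_sdiff (finite_singleton x)

lemma IsSphere.finite {d : ℤ} (h : IsSphere Γ d A) : A.Finite := by
  cases h with
  | empty => exact finite_empty
  | step d _ A _ hA =>
    obtain ⟨x, -, hx⟩ := hA
    exact hx.finite.of_sdiff (finite_singleton x)

lemma IsSphere.unitSphere {d : ℤ} (h : IsSphere Γ d A) (hx : x ∈ A) :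
    IsSphere Γ (d - 1) (unitSphere Γ A x) := by
  cases h with
  | empty => exact absurd hx (notMem_empty x)
  | step d _ A hS _ => exact hS x hx

lemma isContractible_of_forall_adj {p : W} (hA : A.Finite) (hp : p ∈ A)
    (h : ∀ y ∈ A, y ≠ p → Γ.Adj p y) : IsContractible Γ A := by
  induction hn : A.ncard using Nat.strong_induction_on generalizing A with
  | _ n ih =>
    by_cases hex : ∃ x ∈ A, x ≠ p
    · obtain ⟨x, hx, hxp⟩ := hex
      have hsub (B : Set W) (hB : B ⊆ A \ {x}) (hpB : p ∈ B) : IsContractible Γ B :=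
        ih _ (hn ▸ ncard_lt_ncard (hB.trans_ssubset (sdiff_singleton_ssubset.2 hx)) hA)
          (hA.subset (hB.trans sdiff_subset)) hpB (fun y hy => h y (hB hy).1) rfl
      exact .extend A x hx (hsub _ unitSphere_subset_sdiff ⟨hp, (h x hx hxp).symm⟩)
        (hsub _ subset_rfl ⟨hp, hxp.symm⟩)
    · push Not at hex
      rw [eq_singleton_iff_unique_mem.2 ⟨hp, hex⟩]
      exact .point p

/-- The vertex `x` is dominated by `p`: its unit sphere is a cone with apex `p`. -/
lemma IsContractible.of_sdiff_singleton {p : W} (hA : A.Finite) (hx : x ∈ A) (hp : p ∈ A)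
    (hxp : Γ.Adj x p) (hdom : ∀ y ∈ A, Γ.Adj x y → y ≠ p → Γ.Adj p y)
    (h : IsContractible Γ (A \ {x})) : IsContractible Γ A :=
  .extend A x hx
    (isContractible_of_forall_adj (hA.subset fun _ hy => hy.1) ⟨hp, hxp⟩
      fun y hy hyp => hdom y hy.1 hy.2 hyp)
    h

lemma unitSphere_union_left (hAB : Γ.IsCompleteBetween A B) (hx : x ∈ A) :
    unitSphere Γ (A ∪ B) x = unitSphere Γ A x ∪ B := by
  ext y
  have : y ∈ B → Γ.Adj x y := fun hy => hAB hx hy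
  simp only [DiscreteManifold.unitSphere, mem_ofPred_eq, mem_union]
  tauto

lemma unitSphere_union_right (hAB : Γ.IsCompleteBetween A B) (hx : x ∈ B) :
    unitSphere Γ (A ∪ B) x = A ∪ unitSphere Γ B x := by
  rw [union_comm, unitSphere_union_left hAB.symm hx, union_comm]

lemma union_sdiff_singleton_left (hAB : Γ.IsCompleteBetween A B) (hx : x ∈ A) :
    (A ∪ B) \ {x} = A \ {x} ∪ B := by
  rw [union_sdiff_distrib, sdiff_singleton_eq_self (disjoint_left.1 hAB.disjoint hx)]

lemma IsContractible.union (hA : IsContractible Γ A) (hB : B.Finite)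
    (hAB : Γ.IsCompleteBetween A B) : IsContractible Γ (A ∪ B) := by
  induction hA with
  | point x =>
    refine isContractible_of_forall_adj ((finite_singleton x).union hB) (.inl rfl) ?_
    rintro y (hy | hy) hyx
    · exact absurd hy hyx
    · exact hAB rfl hy
  | extend A x hx _ _ ihS ihA =>
    refine .extend _ x (.inl hx) ?_ ?_
    · rw [unitSphere_union_left hAB hx]
      exact ihS fun _ hz => hAB hz.1
    · rw [union_sdiff_singleton_left hAB hx]
      exact ihA fun _ hz => hAB hz.1

lemma IsSphere.union {a b : ℤ} (hA : IsSphere Γ a A) (hB : IsSphere Γ b B)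
    (hAB : Γ.IsCompleteBetween A B) : IsSphere Γ (a + b + 1) (A ∪ B) := by
  induction hA generalizing b B with
  | empty => simpa using hB
  | step a ha A hSA hA ihA =>
    induction hB with
    | empty => simpa using IsSphere.step a ha A hSA hA
    | step b hb B hSB hB ihB =>
      have sphereB := IsSphere.step b hb B hSB hB
      refine .step _ (by lia) _ ?_ ?_
      · rintro x (hx | hx)
        · rw [unitSphere_union_left hAB hx, show a + b + 1 - 1 = a - 1 + b + 1 by ring]
          exact ihA x hx sphereB fun _ hz => hAB hz.1
        · rw [unitSphere_union_right hAB hx, show a + b + 1 - 1 = a + (b - 1) + 1 by ring]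
          exact ihB x hx fun _ hz _ hy => hAB hz hy.1
      · obtain ⟨x, hx, hAx⟩ := hA
        refine ⟨x, .inl hx, ?_⟩
        rw [union_sdiff_singleton_left hAB hx]
        exact hAx.union sphereB.finite fun _ hz => hAB hz.1

end Graphs

section Posets

/-- The comparability graph of a preorder, in which `a` and `b` are adjacent if `a < b` or `b < a`.
It is the graph underlying the order complex; `inclusionGraph V` is the case of `Finset V`. -/
def comparabilityGraph (α : Type*) [Preorder α] : SimpleGraph α where
  Adj a b := a < b ∨ b < a
  symm := ⟨fun _ _ => Or.symm⟩
  loopless := ⟨fun a h => h.elim (lt_irrefl a) (lt_irrefl a)⟩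

lemma inclusionGraph_eq (V : Type*) : inclusionGraph V = comparabilityGraph (Finset V) := rfl

section Preorder

variable {α : Type*} [Preorder α] {A : Set α} {a b x : α}

lemma unitSphere_comparabilityGraph (A : Set α) (x : α) :
    unitSphere (comparabilityGraph α) A x = A ∩ Iio x ∪ A ∩ Ioi x := by
  ext y
  simp only [unitSphere, comparabilityGraph, mem_ofPred_eq, mem_union, mem_inter_iff, mem_Iio,
    mem_Ioi]
  tauto

lemma isSphere_unitSphere_comparabilityGraph {m n : ℤ}
    (hlt : IsSphere (comparabilityGraph α) m (A ∩ Iio x))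
    (hgt : IsSphere (comparabilityGraph α) n (A ∩ Ioi x)) :
    IsSphere (comparabilityGraph α) (m + n + 1) (unitSphere (comparabilityGraph α) A x) := by
  rw [unitSphere_comparabilityGraph]
  exact hlt.union hgt fun _ hy _ hz => .inl (hy.2.trans hz.2)

lemma unitSphere_inter_Ioi_of_covBy (hab : a ⋖ b) :
    unitSphere (comparabilityGraph α) (A ∩ Ioi a) b = A ∩ Ioi b := by
  rw [unitSphere_comparabilityGraph, inter_assoc, Ioi_inter_Iio, hab.Ioo_eq, inter_empty,
    empty_union, inter_assoc,
    inter_eq_self_of_subset_right (Ioi_subset_Ioi hab.le)]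

lemma isSphere_unitSphere_inter_Iio {m n : ℤ} (hA : IsUpperSet A) (hx : x ∈ A) (hxb : x < b)
    (hlt : IsSphere (comparabilityGraph α) m (A ∩ Iio x))
    (hgt : IsSphere (comparabilityGraph α) n (Ioo x b)) :
    IsSphere (comparabilityGraph α) (m + n + 1)
      (unitSphere (comparabilityGraph α) (A ∩ Iio b) x) := by
  refine isSphere_unitSphere_comparabilityGraph ?_ ?_
  · rwa [inter_assoc, inter_eq_self_of_subset_right (Iio_subset_Iio hxb.le)]
  · convert hgt using 1
    exact Set.ext fun y => ⟨fun hy => ⟨hy.2, hy.1.2⟩, fun hy => ⟨⟨hA hy.1.le hx, hy.2⟩, hy.1⟩⟩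

end Preorder

section PartialOrder

variable {α : Type*} [PartialOrder α] {A : Set α} {p : α} {g : α → α}

lemma isContractible_of_isLeast (hA : A.Finite) (hp : IsLeast A p) :
    IsContractible (comparabilityGraph α) A :=
  isContractible_of_forall_adj hA hp.1 fun _ hy hyp => .inl ((hp.2 hy).lt_of_ne hyp.symm)

lemma isContractible_of_isGreatest (hA : A.Finite) (hp : IsGreatest A p) :
    IsContractible (comparabilityGraph α) A :=
  isContractible_of_forall_adj hA hp.1 fun _ hy hyp => .inr ((hp.2 hy).lt_of_ne hyp)

/-- If `g` moves some point up, take a maximal such point; otherwise take a minimal point which is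
moved down. -/
lemma exists_dominated_of_retraction (hA : A.Finite) (hmono : MonotoneOn g A)
    (hcomp : ∀ x ∈ A, x ≤ g x ∨ g x ≤ x) (hmoved : ∃ x ∈ A, g x ≠ x) :
    ∃ x ∈ A, g x ≠ x ∧ ∀ y ∈ A, (comparabilityGraph α).Adj x y → y ≠ g x →
      (comparabilityGraph α).Adj (g x) y := by
  by_cases hup : ∃ x ∈ A, x < g x
  · obtain ⟨x, ⟨hx, hxg⟩, hmax⟩ := (hA.sep (fun x => x < g x)).exists_maximal hup
    refine ⟨x, hx, hxg.ne', fun y hy hxy hne => ?_⟩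
    rcases hxy with hxy | hyx
    · have hgy : g y ≤ y := by
        by_contra hgy
        have hyg : y ≤ g y := (hcomp y hy).resolve_right hgy
        exact (hmax ⟨hy, hyg.lt_of_not_ge hgy⟩ hxy.le).not_gt hxy
      exact .inl (((hmono hx hy hxy.le).trans hgy).lt_of_ne hne.symm)
    · exact .inr (hyx.trans hxg)
  · push Not at hup
    have hle (x) (hx : x ∈ A) : g x ≤ x := (hcomp x hx).elim
      (fun h => (eq_of_le_of_not_lt h (hup x hx)).ge) id
    obtain ⟨x, ⟨hx, hgx⟩, hmin⟩ := (hA.sep (fun x => g x ≠ x)).exists_minimal hmoved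
    refine ⟨x, hx, hgx, fun y hy hxy hne => ?_⟩
    rcases hxy with hxy | hyx
    · exact .inl (((hle x hx).lt_of_ne hgx).trans hxy)
    · have hgy : g y = y := by
        by_contra hgy
        exact (hmin ⟨hy, hgy⟩ hyx.le).not_gt hyx
      exact .inr ((hgy.ge.trans (hmono hy hx hyx.le)).lt_of_ne hne)

lemma IsContractible.of_retraction (hA : A.Finite) (hmaps : MapsTo g A A)
    (hmono : MonotoneOn g A) (hcomp : ∀ x ∈ A, x ≤ g x ∨ g x ≤ x)
    (hidem : ∀ x ∈ A, g (g x) = g x)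
    (hfix : IsContractible (comparabilityGraph α) (A ∩ fixedPoints g)) :
    IsContractible (comparabilityGraph α) A := by
  induction hn : A.ncard using Nat.strong_induction_on generalizing A with
  | _ n ih =>
    by_cases hmoved : ∃ x ∈ A, g x ≠ x
    · obtain ⟨x, hx, hgx, hdom⟩ := exists_dominated_of_retraction hA hmono hcomp hmoved
      have hadj : (comparabilityGraph α).Adj x (g x) :=
        (hcomp x hx).imp (·.lt_of_ne hgx.symm) (·.lt_of_ne hgx)
      have hfix_sdiff : A \ {x} ∩ fixedPoints g = A ∩ fixedPoints g := by
        rw [← inter_sdiff_right_comm, sdiff_singleton_eq_self fun h => hgx h.2]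
      refine .of_sdiff_singleton hA hx (hmaps hx) hadj hdom ?_
      refine ih _ (hn ▸ ncard_sdiff_singleton_lt_of_mem hx hA) (hA.subset sdiff_subset) ?_
        (hmono.mono sdiff_subset) (fun y hy => hcomp y hy.1) (fun y hy => hidem y hy.1)
        (hfix_sdiff ▸ hfix) rfl
      exact fun y hy => ⟨hmaps hy.1, fun hgy => hgx (hgy ▸ hidem y hy.1)⟩
    · push Not at hmoved
      have hsub : A ⊆ fixedPoints g := hmoved
      rwa [inter_eq_self_of_subset_left hsub] at hfix

end PartialOrder

end Posets

section FinsetPoset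

variable {V : Type*} {F : Set (Finset V)} {c y z : Finset V}

lemma isContractible_of_inter_mem [DecidableEq V] {A : Set (Finset V)} (hA : A.Finite)
    (hc : c ∈ A) (h : ∀ w ∈ A, w ∩ c ∈ A) : IsContractible (comparabilityGraph (Finset V)) A := by
  refine .of_retraction hA (g := (· ∩ c)) h
    (fun _ _ _ _ hab => Finset.inter_subset_inter_right hab)
    (fun _ _ => .inr Finset.inter_subset_left) (fun w _ => by simp) ?_
  exact isContractible_of_isGreatest (hA.subset inter_subset_left)
    ⟨⟨hc, Finset.inter_self c⟩, fun w hw => Finset.inter_eq_left.1 hw.2⟩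

/-- The map `w ↦ insert v w` is a retraction because its only value that is lost, `y`, is taken
only at the removed set `y.erase v`. -/
lemma isContractible_inter_Iio_sdiff_erase [DecidableEq V] (hF : IsUpperSet F) {v : V}
    (hv : v ∈ y)
    (h : IsContractible (comparabilityGraph (Finset V)) {w | w ∈ F ∩ Iio y ∧ v ∈ w}) :
    IsContractible (comparabilityGraph (Finset V)) ((F ∩ Iio y) \ {y.erase v}) := by
  refine .of_retraction (g := insert v) (((finite_Iio y).inter_of_right F).sdiff) ?_
    (fun _ _ _ _ hab => Finset.insert_subset_insert v hab)
    (fun w _ => .inl (Finset.subset_insert v w)) (fun w _ => Finset.insert_idem v w) ?_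
  · rintro w ⟨⟨hwF, hwy⟩, hwe⟩
    have hne : insert v w ≠ y := by
      rintro rfl
      by_cases hvw : v ∈ w
      · exact hwy.ne (Finset.insert_eq_of_mem hvw).symm
      · exact hwe (Finset.erase_insert hvw).symm
    refine ⟨⟨hF (Finset.subset_insert v w) hwF,
      (Finset.insert_subset hv hwy.le).lt_of_ne hne⟩, fun he => ?_⟩
    exact Finset.notMem_erase v y (he ▸ Finset.mem_insert_self v w)
  · convert h using 1
    ext w
    simp only [mem_inter_iff, mem_sdiff, mem_singleton_iff, mem_fixedPoints, IsFixedPt,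
      Finset.insert_eq_self, mem_ofPred_eq]
    refine ⟨fun hw => ⟨hw.1.1, hw.2⟩, fun hw => ⟨⟨hw.1, ?_⟩, hw.2⟩⟩
    rintro rfl
    exact Finset.notMem_erase v y hw.2

/-- The open interval is the barycentric refinement of the boundary of the simplex `y \ z`. -/
lemma isSphere_Ioo (hzy : z < y) :
    IsSphere (comparabilityGraph (Finset V)) (#y - #z - 2) (Ioo z y) := by
  classical
  induction hn : #y - #z using Nat.strong_induction_on generalizing z y with
  | _ n ih =>
    obtain ⟨v, hvy, hvz⟩ := Finset.exists_of_ssubset hzy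
    have hcard_insert : #(insert v z) = #z + 1 := Finset.card_insert_of_notMem hvz
    rcases (Finset.insert_subset hvy hzy.le).eq_or_lt with rfl | hlt
    · rw [(Finset.covBy_insert hvz).Ioo_eq, hcard_insert]
      convert IsSphere.empty using 1
      lia
    have hcard_lt : #z + 1 < #y := hcard_insert ▸ Finset.card_lt_card hlt
    have hze : z < y.erase v := by
      refine (Finset.subset_erase.2 ⟨hzy.le, hvz⟩).lt_of_ne fun he => ?_
      have := Finset.card_erase_add_one hvy
      lia
    refine .step _ (by lia) _ ?_ ⟨y.erase v, ⟨hze, Finset.erase_ssubset hvy⟩, ?_⟩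
    · rintro w ⟨hzw, hwy⟩
      have hcard_zw := Finset.card_lt_card hzw
      have hcard_wy := Finset.card_lt_card hwy
      rw [show (#y - #z - 2 - 1 : ℤ) = (#w - #z - 2) + (#y - #w - 2) + 1 by ring, ← Ioi_inter_Iio]
      exact isSphere_unitSphere_inter_Iio (isUpperSet_Ioi z) hzw hwy
        (by rw [Ioi_inter_Iio]; exact ih _ (by lia) hzw rfl) (ih _ (by lia) hwy rfl)
    · rw [← Ioi_inter_Iio]
      refine isContractible_inter_Iio_sdiff_erase (isUpperSet_Ioi z) hvy
        (isContractible_of_isLeast (p := insert v z) ?_ ?_)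
      · exact (finite_Iio y).subset fun w hw => hw.1.2
      · exact ⟨⟨⟨Finset.ssubset_insert hvz, hlt⟩, Finset.mem_insert_self v z⟩,
          fun w hw => Finset.insert_subset hw.2 hw.1.1.le⟩

end FinsetPoset

section SurjOn

variable {V β : Type*} {f : V → β} {y : Finset V}

lemma isUpperSet_setOf_surjOn_univ (f : V → β) :
    IsUpperSet {z : Finset V | SurjOn f z univ} :=
  fun _ _ hzw hz => hz.mono (Finset.coe_subset.2 hzw) subset_rfl

lemma surjOn_erase_univ [DecidableEq V] {v v' : V} (hy : SurjOn f y univ) (hv' : v' ∈ y)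
    (hne : v' ≠ v) (hf : f v' = f v) : SurjOn f (y.erase v) univ := by
  intro b hb
  obtain ⟨u, hu, rfl⟩ := hy hb
  by_cases huv : u = v
  · exact ⟨v', by simp [hne, hv'], huv ▸ hf⟩
  · exact ⟨u, by simpa [huv] using hu, rfl⟩

/-- The set `c` obtained from `y` by deleting the points other than `v` of the fibre of `v` is
proper, and intersecting with it preserves surjectivity of `f` on sets that contain `v`. -/
lemma isContractible_setOf_surjOn_univ_inter_Iio_mem {v v' : V} (hy : SurjOn f y univ)
    (hv : v ∈ y) (hv' : v' ∈ y) (hne : v' ≠ v) (hf : f v' = f v) :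
    IsContractible (comparabilityGraph (Finset V))
      {w | w ∈ {z : Finset V | SurjOn f z univ} ∩ Iio y ∧ v ∈ w} := by
  classical
  let c := y.filter fun u => u = v ∨ f u ≠ f v
  have hvc : v ∈ c := by simp [c, hv]
  have hcy : c < y := by
    refine (Finset.filter_subset _ y).lt_of_ne fun he => ?_
    have hv'c := Finset.filter_eq_self.1 he v' hv'
    exact hv'c.elim hne (· hf)
  have hinter (w : Finset V) (hwy : w ≤ y) (hvw : v ∈ w) (hw : SurjOn f w univ) :
      SurjOn f (w ∩ c : Finset V) univ := by
    intro b hb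
    obtain ⟨u, hu, rfl⟩ := hw hb
    by_cases hfu : f u = f v
    · exact ⟨v, by simp [hvw, hvc], hfu.symm⟩
    · exact ⟨u, by simp [c, hfu, hwy hu, Finset.mem_coe.1 hu], rfl⟩
  refine isContractible_of_inter_mem (c := c) ((finite_Iio y).subset fun w hw => hw.1.2) ?_ ?_
  · refine ⟨⟨?_, hcy⟩, hvc⟩
    simpa [Finset.inter_eq_right.2 hcy.le] using hinter y le_rfl hv hy
  · rintro w ⟨⟨hw, hwy⟩, hvw⟩
    exact ⟨⟨hinter w hwy.le hvw hw, Finset.inter_subset_left.trans_lt hwy⟩,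
      Finset.mem_inter.2 ⟨hvw, hvc⟩⟩

/-- These sets are the proper faces of the product of the simplices spanned by the fibres of `f`
on `y`, whence a sphere. -/
lemma isSphere_setOf_surjOn_univ_inter_Iio [Fintype β] (hy : SurjOn f y univ) :
    IsSphere (comparabilityGraph (Finset V)) (#y - Fintype.card β - 1)
      ({z : Finset V | SurjOn f z univ} ∩ Iio y) := by
  classical
  have hcard_le (z : Finset V) (hz : SurjOn f z univ) : Fintype.card β ≤ #z :=
    Finset.card_le_card_of_surjOn f (by simpa using hz)
  induction hn : #y using Nat.strong_induction_on generalizing y with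
  | _ n ih =>
    subst hn
    by_cases hinj : InjOn f y
    · have hcard_y : #y = Fintype.card β :=
        (Finset.card_le_card_of_injOn f (fun _ _ => Finset.mem_univ _) hinj).antisymm
          (hcard_le y hy)
      have hempty : {z : Finset V | SurjOn f z univ} ∩ Iio y = ∅ :=
        eq_empty_of_forall_notMem fun w hw =>
          ((Finset.card_lt_card hw.2).trans_eq hcard_y).not_ge (hcard_le w hw.1)
      rw [hempty, hcard_y, sub_self, zero_sub]
      exact .empty
    obtain ⟨v', hv', v, hv, hf, hne⟩ : ∃ v' ∈ y, ∃ v ∈ y, f v' = f v ∧ v' ≠ v := by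
      simpa [InjOn] using hinj
    have herase := surjOn_erase_univ hy hv' hne hf
    have hdim : (0 : ℤ) ≤ #y - Fintype.card β - 1 := by
      have := hcard_le _ herase
      have := Finset.card_erase_add_one hv
      lia
    refine .step _ hdim _ ?_ ⟨y.erase v, ⟨herase, Finset.erase_ssubset hv⟩, ?_⟩
    · rintro w ⟨hw, hwy⟩
      rw [show (#y - Fintype.card β - 1 - 1 : ℤ) =
        (#w - Fintype.card β - 1) + (#y - #w - 2) + 1 by ring]
      exact isSphere_unitSphere_inter_Iio (isUpperSet_setOf_surjOn_univ f) hw hwy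
        (ih _ (Finset.card_lt_card hwy) hw rfl) (isSphere_Ioo hwy)
    · exact isContractible_inter_Iio_sdiff_erase (isUpperSet_setOf_surjOn_univ f) hv
        (isContractible_setOf_surjOn_univ_inter_Iio_mem hy hv hv' hne hf)

end SurjOn

section Manifolds

variable {V β : Type*} {K : PreAbstractSimplicialComplex V} {d m : ℤ} {c t x : Finset V}

lemma nonempty_of_mem_faces (hx : x ∈ K.faces) : x.Nonempty :=
  K.isRelLowerSet_faces.prop_of_mem hx

lemma mem_faces_of_subset (hx : x ∈ K.faces) (htx : t ⊆ x) (ht : t.Nonempty) : t ∈ K.faces :=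
  K.isRelLowerSet_faces.mem_of_le hx htx ht

lemma faces_inter_Ioi_inter_Iio (hx : x ∈ K.faces) : K.faces ∩ Ioi c ∩ Iio x = Ioo c x := by
  rw [inter_assoc, Ioi_inter_Iio]
  exact inter_eq_self_of_subset_right fun y hy =>
    mem_faces_of_subset hx hy.2.le (Finset.empty_ssubset.1 (bot_le.trans_lt hy.1))

lemma faces_inter_Iio (hx : x ∈ K.faces) : K.faces ∩ Iio x = Ioo ∅ x := by
  have hsub : K.faces ⊆ Ioi ∅ := fun y hy => Finset.empty_ssubset.2 (nonempty_of_mem_faces hy)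
  rw [← faces_inter_Ioi_inter_Iio hx, inter_eq_self_of_subset_left hsub]

lemma IsSphere.faces_inter_Ioi_mono
    (hc : IsSphere (comparabilityGraph (Finset V)) m (K.faces ∩ Ioi c)) (hct : c ⊆ t)
    (ht : t ∈ K.faces) :
    IsSphere (comparabilityGraph (Finset V)) (m - (#t - #c)) (K.faces ∩ Ioi t) := by
  classical
  induction hn : #t - #c generalizing m c with
  | zero =>
    obtain rfl := Finset.eq_of_subset_of_card_le hct (by lia)
    simpa using hc
  | succ n ih =>
    obtain ⟨v, hvt, hvc⟩ := Finset.exists_mem_notMem_of_card_lt_card (show #c < #t by lia)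
    have hcard : #(insert v c) = #c + 1 := Finset.card_insert_of_notMem hvc
    have hsub : insert v c ⊆ t := Finset.insert_subset hvt hct
    have hmem : insert v c ∈ K.faces :=
      mem_faces_of_subset ht hsub (Finset.insert_nonempty v c)
    have hsphere := hc.unitSphere ⟨hmem, Finset.ssubset_insert hvc⟩
    rw [unitSphere_inter_Ioi_of_covBy (Finset.covBy_insert hvc)] at hsphere
    convert ih hsphere hsub (by lia) using 1
    lia

lemma isSphere_faces_inter_Ioi_of_forall_singleton
    (h : ∀ v, {v} ∈ K.faces →
      IsSphere (comparabilityGraph (Finset V)) (d - 1) (K.faces ∩ Ioi {v})) (hx : x ∈ K.faces) :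
    IsSphere (comparabilityGraph (Finset V)) (d - #x) (K.faces ∩ Ioi x) := by
  obtain ⟨v, hv⟩ := nonempty_of_mem_faces hx
  have hvx : {v} ⊆ x := Finset.singleton_subset_iff.2 hv
  have hmem := mem_faces_of_subset hx hvx (Finset.singleton_nonempty v)
  convert (h v hmem).faces_inter_Ioi_mono hvx hx using 1
  rw [Finset.card_singleton]
  ring

lemma IsManifold.isSphere_faces_inter_Ioi (hK : IsManifold d K) (hx : x ∈ K.faces) :
    IsSphere (comparabilityGraph (Finset V)) (d - #x) (K.faces ∩ Ioi x) := by
  refine isSphere_faces_inter_Ioi_of_forall_singleton (fun v hv => ?_) hx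
  have hsphere := hK.2 {v} hv
  rwa [inclusionGraph_eq, unitSphere_comparabilityGraph, faces_inter_Iio hv,
    (Finset.empty_covBy_singleton v).Ioo_eq, empty_union] at hsphere

lemma isManifold_of_forall_singleton (hK : K.faces.Finite)
    (h : ∀ v, {v} ∈ K.faces →
      IsSphere (comparabilityGraph (Finset V)) (d - 1) (K.faces ∩ Ioi {v})) :
    IsManifold d K := by
  refine ⟨hK, fun x hx => ?_⟩
  have hbelow : IsSphere (comparabilityGraph (Finset V)) (#x - 2) (K.faces ∩ Iio x) := by
    rw [faces_inter_Iio hx]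
    simpa using isSphere_Ioo (Finset.empty_ssubset.2 (nonempty_of_mem_faces hx))
  rw [inclusionGraph_eq, show d - 1 = (#x - 2) + (d - #x) + 1 by ring]
  exact isSphere_unitSphere_comparabilityGraph hbelow
    (isSphere_faces_inter_Ioi_of_forall_singleton h hx)

lemma IsManifold.isManifoldGraph_faces_inter_setOf_surjOn_univ [Fintype β] [Nonempty β]
    (hK : IsManifold d K) (f : V → β) :
    IsManifoldGraph (inclusionGraph V) (d + 1 - Fintype.card β)
      (K.faces ∩ {y | SurjOn f y univ}) := by
  refine ⟨hK.1.inter_of_left _, fun y ⟨hyK, hyf⟩ => ?_⟩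
  have hbelow : K.faces ∩ {y | SurjOn f y univ} ∩ Iio y =
      {z : Finset V | SurjOn f z univ} ∩ Iio y := by
    rw [inter_assoc]
    refine inter_eq_self_of_subset_right fun z ⟨hz, hzy⟩ => ?_
    obtain ⟨v, hv, -⟩ := hz (mem_univ (Classical.arbitrary β))
    exact mem_faces_of_subset hyK hzy.le ⟨v, hv⟩
  have habove : K.faces ∩ {y | SurjOn f y univ} ∩ Ioi y = K.faces ∩ Ioi y := by
    have hsub : Ioi y ⊆ {z : Finset V | SurjOn f z univ} := fun z hyz =>
      isUpperSet_setOf_surjOn_univ f (le_of_lt hyz) hyf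
    rw [inter_assoc, inter_eq_self_of_subset_right hsub]
  rw [inclusionGraph_eq, show d + 1 - Fintype.card β - 1 =
    (#y - Fintype.card β - 1) + (d - #y) + 1 by ring]
  refine isSphere_unitSphere_comparabilityGraph ?_ ?_
  · rw [hbelow]
    exact isSphere_setOf_surjOn_univ_inter_Iio hyf
  · rw [habove]
    exact hK.isSphere_faces_inter_Ioi hyK

end Manifolds

section CliqueComplex

variable {W : Type*} {Γ : SimpleGraph W} {A : Set W} {c : Finset W} {x : W} {m : ℤ}

/-- The link of `c` in the graph induced on `A`: the vertices of `A` adjacent to all of `c`. For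
`c = {x}` it is the unit sphere of `x`. -/
def link (Γ : SimpleGraph W) (A : Set W) (c : Finset W) : Set W :=
  {y | y ∈ A ∧ ∀ z ∈ c, Γ.Adj z y}

lemma link_singleton (Γ : SimpleGraph W) (A : Set W) (x : W) : link Γ A {x} = unitSphere Γ A x := by
  simp [link, unitSphere]

lemma link_insert [DecidableEq W] (Γ : SimpleGraph W) (A : Set W) (c : Finset W) (x : W) :
    link Γ A (insert x c) = unitSphere Γ (link Γ A c) x := by
  ext y
  simp only [link, unitSphere, mem_ofPred_eq, Finset.forall_mem_insert]
  tauto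

lemma link_sdiff (Γ : SimpleGraph W) (A B : Set W) (c : Finset W) :
    link Γ (A \ B) c = link Γ A c \ B := by
  ext y
  simp only [link, mem_sdiff, mem_ofPred_eq]
  tauto

lemma notMem_of_mem_link (hx : x ∈ link Γ A c) : x ∉ c :=
  fun hxc => Γ.irrefl (hx.2 x hxc)

lemma mem_cliqueComplex_faces {t : Finset W} :
    t ∈ (cliqueComplex Γ A).faces ↔ t.Nonempty ∧ (t : Set W) ⊆ A ∧ Γ.IsClique (t : Set W) :=
  Iff.rfl

lemma finite_cliqueComplex_faces (hA : A.Finite) : (cliqueComplex Γ A).faces.Finite :=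
  hA.finite_subsets.preimage Finset.coe_injective.injOn |>.subset fun _ ht => ht.2.1

lemma insert_mem_cliqueComplex_faces [DecidableEq W] (hc : c ∈ (cliqueComplex Γ A).faces)
    (hx : x ∈ link Γ A c) : insert x c ∈ (cliqueComplex Γ A).faces := by
  refine ⟨Finset.insert_nonempty x c, ?_, ?_⟩ <;> rw [Finset.coe_insert]
  · exact insert_subset hx.1 hc.2.1
  · exact hc.2.2.insert fun y hy _ => (hx.2 y hy).symm

lemma exists_mem_link_of_lt {t : Finset W} (ht : t ∈ (cliqueComplex Γ A).faces) (hct : c < t) :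
    ∃ x ∈ link Γ A c, x ∈ t := by
  obtain ⟨x, hxt, hxc⟩ := Finset.exists_of_ssubset hct
  exact ⟨x, ⟨ht.2.1 hxt, fun y hy => ht.2.2 (hct.le hy) hxt (ne_of_mem_of_not_mem hy hxc)⟩, hxt⟩

lemma cliqueComplex_sdiff_singleton_faces :
    (cliqueComplex Γ (A \ {x})).faces = {t | t ∈ (cliqueComplex Γ A).faces ∧ x ∉ t} := by
  ext t
  simp only [mem_cliqueComplex_faces, subset_sdiff, disjoint_singleton_right, Finset.mem_coe,
    mem_ofPred_eq]
  tauto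

lemma isContractible_cliqueComplex_sdiff_insert [DecidableEq W] (hA : A.Finite) (hxc : x ∉ c)
    (h : IsContractible (comparabilityGraph (Finset W))
      ((cliqueComplex Γ (A \ {x})).faces ∩ Ioi c)) :
    IsContractible (comparabilityGraph (Finset W))
      (((cliqueComplex Γ A).faces ∩ Ioi c) \ {insert x c}) := by
  refine .of_retraction (g := (Finset.erase · x))
    (((finite_cliqueComplex_faces hA).inter_of_left _).sdiff) ?_
    (fun _ _ _ _ hab => Finset.erase_subset_erase x hab)
    (fun t _ => .inr (Finset.erase_subset x t)) (fun t _ => Finset.erase_idem) ?_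
  · rintro t ⟨⟨ht, hct⟩, hne⟩
    have hlt : c < t.erase x := by
      refine (Finset.subset_erase.2 ⟨hct.le, hxc⟩).lt_of_ne ?_
      rintro rfl
      by_cases hxt : x ∈ t
      · exact hne (Finset.insert_erase hxt).symm
      · exact hct.ne (Finset.erase_eq_of_notMem hxt)
    refine ⟨⟨mem_faces_of_subset ht (Finset.erase_subset x t)
      (Finset.empty_ssubset.1 (bot_le.trans_lt hlt)), hlt⟩, fun he : t.erase x = insert x c => ?_⟩
    exact Finset.notMem_erase x t (he ▸ Finset.mem_insert_self x c)
  · convert h using 1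
    ext t
    simp only [cliqueComplex_sdiff_singleton_faces, mem_inter_iff, mem_sdiff, mem_singleton_iff,
      mem_fixedPoints, IsFixedPt, Finset.erase_eq_self, mem_ofPred_eq]
    have : x ∉ t → t ≠ insert x c := by
      rintro hxt rfl
      exact hxt (Finset.mem_insert_self x c)
    tauto

lemma IsContractible.cliqueComplex_inter_Ioi (hA : A.Finite) (hc : c ∈ (cliqueComplex Γ A).faces)
    (h : IsContractible Γ (link Γ A c)) :
    IsContractible (comparabilityGraph (Finset W)) ((cliqueComplex Γ A).faces ∩ Ioi c) := by
  classical
  generalize hL : link Γ A c = L at h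
  induction h generalizing A c with
  | point x =>
    have hx : x ∈ link Γ A c := hL ▸ mem_singleton x
    refine isContractible_of_isLeast ((finite_cliqueComplex_faces hA).inter_of_left _)
      ⟨⟨insert_mem_cliqueComplex_faces hc hx, Finset.ssubset_insert (notMem_of_mem_link hx)⟩, ?_⟩
    rintro t ⟨ht, hct⟩
    obtain ⟨y, hy, hyt⟩ := exists_mem_link_of_lt ht hct
    obtain rfl : y = x := by simpa [hL] using hy
    exact Finset.insert_subset hyt hct.le
  | extend L x hxL _ _ ihS ihL =>
    subst hL
    have hxc := notMem_of_mem_link hxL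
    have hinsert := insert_mem_cliqueComplex_faces hc hxL
    refine .extend _ (insert x c) ⟨hinsert, Finset.ssubset_insert hxc⟩ ?_ ?_
    · rw [unitSphere_inter_Ioi_of_covBy (Finset.covBy_insert hxc)]
      exact ihS hA hinsert (link_insert Γ A c x)
    · refine isContractible_cliqueComplex_sdiff_insert hA hxc
        (ihL hA.sdiff ?_ (link_sdiff Γ A {x} c))
      rw [cliqueComplex_sdiff_singleton_faces]
      exact ⟨hc, hxc⟩

lemma IsSphere.cliqueComplex_inter_Ioi (hA : A.Finite) (hc : c ∈ (cliqueComplex Γ A).faces)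
    (h : IsSphere Γ m (link Γ A c)) :
    IsSphere (comparabilityGraph (Finset W)) m ((cliqueComplex Γ A).faces ∩ Ioi c) := by
  classical
  generalize hL : link Γ A c = L at h
  induction h generalizing c with
  | empty =>
    convert IsSphere.empty using 1
    refine eq_empty_of_forall_notMem fun t ⟨ht, hct⟩ => ?_
    obtain ⟨x, hx, -⟩ := exists_mem_link_of_lt ht hct
    exact notMem_empty x (hL ▸ hx)
  | step m hm L _ hL' ih =>
    subst hL
    refine .step m hm _ ?_ ?_
    · rintro t ⟨ht, hct⟩
      obtain ⟨x, hx, hxt⟩ := exists_mem_link_of_lt ht hct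
      have hinsert := ih x hx (insert_mem_cliqueComplex_faces hc hx) (link_insert Γ A c x)
      have hinsert_le : insert x c ≤ t := Finset.insert_subset hxt hct.le
      have hcard : #(insert x c) = #c + 1 := Finset.card_insert_of_notMem (notMem_of_mem_link hx)
      rw [show m - 1 = (#t - #c - 2) + (m - 1 - (#t - #(insert x c))) + 1 by
        rw [hcard]; push_cast; ring]
      refine isSphere_unitSphere_comparabilityGraph ?_ ?_
      · rw [faces_inter_Ioi_inter_Iio ht]
        exact isSphere_Ioo hct
      · rw [inter_assoc, inter_eq_self_of_subset_right (Ioi_subset_Ioi hct.le)]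
        exact hinsert.faces_inter_Ioi_mono hinsert_le ht
    · obtain ⟨x, hx, hcontr⟩ := hL'
      have hxc := notMem_of_mem_link hx
      refine ⟨insert x c,
        ⟨insert_mem_cliqueComplex_faces hc hx, Finset.ssubset_insert hxc⟩,
        isContractible_cliqueComplex_sdiff_insert hA hxc
          (.cliqueComplex_inter_Ioi hA.sdiff ?_ ?_)⟩
      · rw [cliqueComplex_sdiff_singleton_faces]
        exact ⟨hc, hxc⟩
      · rwa [link_sdiff]

lemma IsManifoldGraph.cliqueComplex (hA : IsManifoldGraph Γ m A) :
    IsManifold m (cliqueComplex Γ A) := by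
  refine isManifold_of_forall_singleton (finite_cliqueComplex_faces hA.1) fun x hx => ?_
  refine IsSphere.cliqueComplex_inter_Ioi hA.1 hx ?_
  rw [link_singleton]
  exact hA.2 x (hx.2.1 (Finset.mem_coe.2 (Finset.mem_singleton_self x)))

end CliqueComplex

lemma pullbackSet_completeComplex {V : Type*} {k : ℕ} (G : AbstractSimplicialComplex V)
    (f : V → Fin (k + 1)) :
    pullbackSet G f (completeComplex k) = G.faces ∩ {y | SurjOn f y univ} := by
  have hmax (t : Finset (Fin (k + 1))) :
      Maximal (fun s => s ∈ (completeComplex k).faces) t ↔ t = Finset.univ := by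
    refine ⟨fun ht => Finset.univ_subset_iff.1 (ht.2 Finset.univ_nonempty (Finset.subset_univ t)),
      ?_⟩
    rintro rfl
    exact ⟨Finset.univ_nonempty, fun s _ _ => Finset.subset_univ s⟩
  ext y
  simp [pullbackSet, hmax, SurjOn, ← Finset.coe_subset]

end DiscreteManifold

open DiscreteManifold in
/-- `G` is a `d`-manifold with vertex set `V` and `f : V → {0,…,k}` is surjective. Then
`H = H(G, f, K_{k+1})` is empty or a `(d-k)`-manifold, both as a graph (the inclusion graph on the
simplices `y` of `G` with `f(y) = {0,…,k}`) and as the complex of complete subgraphs of it. -/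
theorem mainTheorem2 {V : Type*} (d k : ℕ) (G : AbstractSimplicialComplex V)
    (hG : IsManifold (d : ℤ) G.toPreAbstractSimplicialComplex)
    (f : V → Fin (k + 1)) (hf : Function.Surjective f) :
    (IsManifoldGraph (inclusionGraph V) ((d : ℤ) - (k : ℤ))
        (pullbackSet G f (completeComplex k)) ∧
      IsManifold ((d : ℤ) - (k : ℤ)) (pullback G f (completeComplex k))) ∨
    (pullback G f (completeComplex k)).faces = ∅ := by
  left
  have hU := hG.isManifoldGraph_faces_inter_setOf_surjOn_univ f
  rw [← pullbackSet_completeComplex, Fintype.card_fin, Nat.cast_succ, add_sub_add_right_eq_sub]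
    at hU
  exact ⟨hU, hU.cliqueComplex⟩
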